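/- Let $n\ge 0$ and $c\ge 1$ be integers, let $J$ be a finite set, and for $j\in J$ let $M_j=x_0^{c}x_1^{a_{1,j}}\cdots x_n^{a_{n,j}}\in\mathbb C[x_0,\dots,x_n]$ with $a_{i,j}\ge c$ for all $i,j$. For each $1\le i\le n$ sort the exponents $(a_{i,j})_{j\in J}$ increasingly, with repetitions, and let $\mathcal D_i$ be the multiset of differences of successive exponents. Assume that the collection $\mathcal M=\{M_j\}_{j\in J}$ is free, meaning that for every $i$ the multiset $\mathcal D_i$ contains $1$ at most once, and every element of $\mathcal D_i$ other than $0$ and $1$ is greater than $c$. (In particular this holds if no $\mathcal D_i$ contains a nonzero integer $\le c$.) For a finite collection $\mathcal F=\{F_j\}_{j\in J}$ of forms, of possibly different degrees $d_j=\deg F_j$, the simultaneous Waring rank $\operatorname{rk}_{\mathbb C}\mathcal F$ is the least integer $r\ge 0$ for which there are linear forms $L_1,\dots,L_r$ such that every $F_j$ is a $\mathbb C$-linear combination of $L_1^{d_j},\dots,L_r^{d_j}$; for a single form $F$, $\operatorname{rk}_{\mathbb C}F$ is the rank of the collection $\{F\}$. Then these ranks are well defined (such decompositions exist) for $\mathcal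 M$ and for the greatest common divisor of every nonempty subfamily of $\mathcal M$, and $$ \operatorname{rk}_{\mathbb C}\mathcal M=\sum_{\emptyset\ne S\subseteq J}(-1)^{|S|+1}\operatorname{rk}_{\mathbb C}\gcd(M_j : j\in S). $$ -/

import Mathlib

open MvPolynomial

noncomputable section

/-- The forms `F j` are simultaneously decomposed by `r` linear forms `L 1, …, L r`: each `F j` is a
complex linear combination of the powers `L k ^ deg (F j)`.  The degrees of the `F j` may differ. -/
def HasSimultaneousDecomposition {σ J : Type*} (F : J → MvPolynomial σ ℂ) (r : ℕ) : Prop :=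
  ∃ L : Fin r → MvPolynomial σ ℂ, (∀ k, (L k).IsHomogeneous 1) ∧
    ∀ j, ∃ coeffs : Fin r → ℂ, F j = ∑ k, C (coeffs k) * L k ^ (F j).totalDegree

/-- The simultaneous Waring rank over `ℂ` of a collection of forms: the least number of linear forms
in a simultaneous decomposition. -/
def simultaneousWaringRank {σ J : Type*} (F : J → MvPolynomial σ ℂ) : ℕ :=
  sInf {r | HasSimultaneousDecomposition F r}

/-- The Waring rank over `ℂ` of a single form. -/
def waringRank {σ : Type*} (F : MvPolynomial σ ℂ) : ℕ :=
  simultaneousWaringRank (fun _ : Unit => F)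

/-- The monomial `x₀ ^ c * x₁ ^ a₁ * ⋯ * xₙ ^ aₙ` in `ℂ[x₀, …, xₙ]`. -/
def specialMonomial {n : ℕ} (c : ℕ) (a : Fin n → ℕ) : MvPolynomial (Fin (n + 1)) ℂ :=
  X 0 ^ c * ∏ i : Fin n, X i.succ ^ a i

/-- The greatest common divisor of the monomials `x₀ ^ c * x₁ ^ (a j 1) * ⋯ * xₙ ^ (a j n)`, `j ∈ S`:
the exponent of each variable is the least of its exponents
(`dvd_gcdSpecialMonomial_iff` shows that this is the gcd in the polynomial ring). -/
def gcdSpecialMonomial {n : ℕ} {J : Type*} (c : ℕ) (a : J → Fin n → ℕ) (S : Finset J)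
    (hS : S.Nonempty) : MvPolynomial (Fin (n + 1)) ℂ :=
  specialMonomial c (fun i => S.inf' hS (fun j => a j i))

/-- The multiset of differences of successive elements in the list of the numbers `e j`, `j : J`,
sorted in increasing order and with repetitions kept. -/
def successiveGaps {J : Type*} [Fintype J] (e : J → ℕ) : Multiset ℕ :=
  let l : List ℕ := (Finset.univ.val.map e).sort (· ≤ ·)
  ((List.zipWith (fun x y => y - x) l l.tail : List ℕ) : Multiset ℕ)

/-- For each of the variables `x₁, …, xₙ` the multiset of gaps contains `1` at most once. -/
def IsOneOneFree {n : ℕ} {J : Type*} [Fintype J] (a : J → Fin n → ℕ) : Prop :=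
  ∀ i, (successiveGaps (fun j => a j i)).count 1 ≤ 1

/-- Free collections: for each of the variables `x₁, …, xₙ`, the gap `1` occurs at most once, and
every gap other than `0` and `1` exceeds `c`.  The gap `1`, which is governed by the first clause, is
exempted from the second, so that this condition is implied by the one where it is not exempted
(`isFree_of_forall_gap`). -/
def IsFree {n : ℕ} {J : Type*} [Fintype J] (c : ℕ) (a : J → Fin n → ℕ) : Prop :=
  IsOneOneFree a ∧ ∀ i, ∀ d ∈ successiveGaps (fun j => a j i), d ≠ 0 → d ≠ 1 → c < d

/-- A collection with at most one gap `1` and no nonzero gap `≤ c` at all is free. -/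
theorem isFree_of_forall_gap {n : ℕ} {J : Type*} [Fintype J] {c : ℕ} {a : J → Fin n → ℕ}
    (h₁ : IsOneOneFree a)
    (h₂ : ∀ i, ∀ d ∈ successiveGaps (fun j => a j i), d ≠ 0 → ¬ d ≤ c) : IsFree c a :=
  ⟨h₁, fun i d hd h0 _ => not_le.mp (h₂ i d hd h0)⟩

theorem specialMonomial_eq_monomial {n : ℕ} (c : ℕ) (a : Fin n → ℕ) :
    specialMonomial c a = monomial (Finsupp.equivFunOnFinite.symm (Fin.cons c a)) 1 := by
  rw [monomial_eq, Finsupp.prod_fintype _ _ (by simp), Fin.prod_univ_succ]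
  simp [specialMonomial]

/-- `gcdSpecialMonomial` is the greatest common divisor. -/
theorem dvd_gcdSpecialMonomial_iff {n : ℕ} {J : Type*} (c : ℕ) (a : J → Fin n → ℕ) (S : Finset J)
    (hS : S.Nonempty) (p : MvPolynomial (Fin (n + 1)) ℂ) :
    p ∣ gcdSpecialMonomial c a S hS ↔ ∀ j ∈ S, p ∣ specialMonomial c (a j) := by
  constructor
  · intro h j hj
    refine h.trans (mul_dvd_mul_left _ (Finset.prod_dvd_prod_of_dvd _ _ fun i _ => ?_))
    exact pow_dvd_pow _ (Finset.inf'_le _ hj)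
  · intro h
    obtain ⟨j₀, hj₀⟩ := id hS
    have h0 := h j₀ hj₀
    rw [specialMonomial_eq_monomial, dvd_monomial_iff_exists one_ne_zero] at h0
    obtain ⟨m, b, hm, hb, rfl⟩ := h0
    rw [gcdSpecialMonomial, specialMonomial_eq_monomial, monomial_dvd_monomial]
    refine ⟨Or.inr fun k => ?_, hb⟩
    have key : ∀ j ∈ S, ∀ k, m k ≤ (Fin.cons c (a j) : Fin (n + 1) → ℕ) k := by
      intro j hj k
      have h1 := h j hj
      rw [specialMonomial_eq_monomial, monomial_dvd_monomial] at h1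
      rcases h1.1 with h2 | h2
      · exact absurd h2 one_ne_zero
      · exact h2 k
    refine Fin.cases ?_ (fun i => ?_) k
    · simpa using key j₀ hj₀ 0
    · simp only [Finsupp.equivFunOnFinite_symm_apply_apply, Fin.cons_succ]
      exact Finset.le_inf' _ _ fun j hj => by simpa using key j hj i.succ

end

/-! Both bounds on the rank equal the number of exponent vectors `u` lying under some `a j`, a union
of boxes. Lower bound (`card_divisorExponents_le`): with fewer linear forms, a nonzero polynomial
supported on these exponents vanishes at all the dehomogenized forms. A suitable multiple, divisible
by `x₀ ^ c`, then pairs to zero with every power of the forms but not with some member of the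
family. Upper bound: in each variable take nested sets of `b + 1` points whose nodal polynomial has
its `c` coefficients below the leading one equal to zero. Such a set carries weights whose moments
up to order `b + c` are a delta at `b` (`HasNodalGap.exists_weight`), and product weights on a grid
recover each monomial. Freeness gives the nesting: a gap `d > c` adjoins the roots of `X ^ d = t`,
and a single gap `1` adjoins the point `0`. Nested grids intersect as boxes do, so
inclusion-exclusion gives both unions the same size. Its term for `S` is the rank of the gcd, by the
case of one monomial. -/

noncomputable section

/-! ### Nested point sets with gapped nodal polynomials -/

/-- When the `d`-th roots of `t` are simple, `X ^ d - t` is the nodal polynomial of a finset. -/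
theorem exists_finset_prod_X_sub_C_eq {d : ℕ} (hd : d ≠ 0) {t : ℂ} (ht : t ≠ 0 ∨ d = 1) :
    ∃ B : Finset ℂ, B.card = d ∧ (∀ z ∈ B, z ^ d = t) ∧
      ∏ z ∈ B, (Polynomial.X - Polynomial.C z) = Polynomial.X ^ d - Polynomial.C t := by
  classical
  rcases ht with ht | rfl
  · set f : Polynomial ℂ := Polynomial.X ^ d - Polynomial.C t with hf
    have hm : f.Monic := Polynomial.monic_X_pow_sub_C t hd
    have hs : f.Splits := IsAlgClosed.splits f
    have hn : f.roots.Nodup := Polynomial.nodup_roots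
      (Polynomial.separable_X_pow_sub_C t (Nat.cast_ne_zero.mpr hd) ht)
    refine ⟨⟨f.roots, hn⟩, ?_, ?_, ?_⟩
    · rw [Finset.card_mk, ← hs.natDegree_eq_card_roots, hf, Polynomial.natDegree_X_pow_sub_C]
    · intro z hz
      have := (Polynomial.mem_roots hm.ne_zero).mp (Finset.mem_mk.mp hz)
      simpa [hf, sub_eq_zero] using this
    · exact (hs.eq_prod_roots_of_monic hm).symm
  · exact ⟨{t}, by simp, by simp, by simp⟩

/-- The polynomial vanishing on `A` has the form `X ^ #A + R`, where the degree of `R` is less than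
`#A - c`. -/
def HasNodalGap (c : ℕ) (A : Finset ℂ) : Prop :=
  ∃ R : Polynomial ℂ, ∏ z ∈ A, (Polynomial.X - Polynomial.C z) = Polynomial.X ^ A.card + R ∧
    ∀ s, R.coeff s ≠ 0 → s + c < A.card

theorem exists_hasNodalGap {c m : ℕ} (hm : c < m) :
    ∃ A : Finset ℂ, A.card = m ∧ (0 : ℂ) ∉ A ∧ HasNodalGap c A := by
  obtain ⟨B, hB, hBt, hBp⟩ := exists_finset_prod_X_sub_C_eq (d := m) (t := 1) (by lia) (by simp)
  refine ⟨B, hB, fun h => ?_, -Polynomial.C 1, ?_, fun s hs => ?_⟩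
  · simpa [show m ≠ 0 by lia] using hBt 0 h
  · rw [hBp, hB, sub_eq_add_neg]
  · rw [Polynomial.coeff_neg, Polynomial.coeff_C] at hs
    have : s = 0 := by by_contra h; simp [h] at hs
    lia

/-- Multiplying nodal polynomials, `(X ^ m + R) * (X ^ d - t) = X ^ (m + d) + R * X ^ d - t * X ^ m
- t * R`. Only the term `t * X ^ m` can spoil the gap, and it is harmless when `t = 0` or `c < d`.
-/
theorem HasNodalGap.extend_of_disjoint {c d : ℕ} {A : Finset ℂ} (hA : HasNodalGap c A)
    (hd : d ≠ 0) {t : ℂ} (ht : t ≠ 0 ∨ d = 1) (hct : t = 0 ∨ c < d) (hAt : ∀ z ∈ A, z ^ d ≠ t) :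
    ∃ A', A ⊆ A' ∧ A'.card = A.card + d ∧ HasNodalGap c A' ∧ (0 ∈ A' → 0 ∈ A ∨ t = 0) := by
  classical
  obtain ⟨B, hB, hBt, hBp⟩ := exists_finset_prod_X_sub_C_eq hd ht
  have hdis : Disjoint A B := Finset.disjoint_left.mpr fun z hz hz' => hAt z hz (hBt z hz')
  have hcard : (A ∪ B).card = A.card + d := by rw [Finset.card_union_of_disjoint hdis, hB]
  obtain ⟨R, hR, hRc⟩ := hA
  refine ⟨A ∪ B, Finset.subset_union_left, hcard,
    ⟨R * Polynomial.X ^ d - Polynomial.C t * Polynomial.X ^ A.card - Polynomial.C t * R, ?_, ?_⟩, ?_⟩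
  · rw [Finset.prod_union hdis, hR, hBp, hcard]
    ring
  · intro s hs
    rw [hcard]
    by_contra! hlt
    apply hs
    have h1 : (R * Polynomial.X ^ d).coeff s = 0 := by
      rw [Polynomial.coeff_mul_X_pow']
      split_ifs with h
      · by_contra h'
        have := hRc _ h'
        lia
      · rfl
    have h2 : t * R.coeff s = 0 := by
      by_contra h
      have := hRc s (right_ne_zero_of_mul h)
      lia
    have h3 : t * (Polynomial.X ^ A.card : Polynomial ℂ).coeff s = 0 := by
      rcases hct with rfl | h
      · simp
      · rw [Polynomial.coeff_X_pow, if_neg (by lia), mul_zero]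
    rw [Polynomial.coeff_sub, Polynomial.coeff_sub, Polynomial.coeff_C_mul, Polynomial.coeff_C_mul,
      h1, h2, h3, sub_zero, sub_zero]
  · intro h
    rcases Finset.mem_union.mp h with h | h
    · exact Or.inl h
    · right
      simpa [hd] using (hBt 0 h).symm

theorem HasNodalGap.exists_superset {c d : ℕ} {A : Finset ℂ} (hA : HasNodalGap c A) (hd : d ≠ 0)
    (h : d = 1 ∧ 0 ∉ A ∨ c < d ∧ 1 < d) :
    ∃ A', A ⊆ A' ∧ A'.card = A.card + d ∧ HasNodalGap c A' ∧ (0 ∈ A' → 0 ∈ A ∨ d = 1) := by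
  classical
  rcases h with ⟨rfl, h⟩ | ⟨h, h1⟩
  -- A gap `1` need not exceed `c`, so the only available choice is `t = 0`; it adjoins the point
  -- `0`, which can happen only once.
  · obtain ⟨A', h1, h2, h3, -⟩ := hA.extend_of_disjoint (d := 1) (t := 0) (by simp) (by simp)
      (by simp) (fun z hz h0 => h (by simpa [show z = 0 by simpa using h0] using hz))
    exact ⟨A', h1, h2, h3, fun _ => Or.inr rfl⟩
  · obtain ⟨t, ht⟩ := Infinite.exists_notMem_finset (insert 0 (A.image (· ^ d)))
    simp only [Finset.mem_insert, Finset.mem_image, not_or, not_exists, not_and] at ht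
    obtain ⟨A', h1, h2, h3, h4⟩ := hA.extend_of_disjoint (t := t) hd (Or.inl ht.1) (Or.inr h) ht.2
    exact ⟨A', h1, h2, h3, fun h => Or.inl ((h4 h).resolve_right ht.1)⟩

/-- Nested point sets whose sizes exceed the elements of a sorted list by one. -/
theorem exists_nested_hasNodalGap_of_isChain {c : ℕ} (l : List ℕ) :
    ∀ (x : ℕ) (A₀ : Finset ℂ), (x :: l).Pairwise (· ≤ ·) → A₀.card = x + 1 → HasNodalGap c A₀ →
    (List.zipWith (fun x y => y - x) (x :: l) l).count 1 ≤ 1 →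
    (0 ∈ A₀ → (List.zipWith (fun x y => y - x) (x :: l) l).count 1 = 0) →
    (∀ d ∈ List.zipWith (fun x y => y - x) (x :: l) l, d ≠ 0 → d ≠ 1 → c < d) →
    ∃ A : ℕ → Finset ℂ, A x = A₀ ∧ (∀ y ∈ x :: l, (A y).card = y + 1 ∧ HasNodalGap c (A y)) ∧
      ∀ y ∈ x :: l, ∀ z ∈ x :: l, y ≤ z → A y ⊆ A z := by
  induction l with
  | nil =>
    intro x A₀ _ h1 h2 _ _ _
    exact ⟨fun _ => A₀, rfl, by simp [h1, h2], by simp⟩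
  | cons y l ih =>
    intro x A₀ hs hcard hgap hone hzero hlarge
    rw [List.zipWith_cons_cons] at hone hzero hlarge
    rw [List.count_cons] at hone hzero
    have hxy : x ≤ y := (List.pairwise_cons.mp hs).1 y (by simp)
    have hyl : ∀ z ∈ y :: l, y ≤ z := by
      intro z hz
      rcases List.mem_cons.mp hz with rfl | hz
      · rfl
      · exact (List.pairwise_cons.mp (List.pairwise_cons.mp hs).2).1 z hz
    have hs' := (List.pairwise_cons.mp hs).2
    have hlarge' := fun d hd => hlarge d (List.mem_cons_of_mem _ hd)
    rcases hxy.eq_or_lt with rfl | hlt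
    · obtain ⟨A, h1, h2, h3⟩ := ih x A₀ hs' hcard hgap (by lia) (fun h => by have := hzero h; lia)
        hlarge'
      refine ⟨A, h1, fun z hz => h2 z (by simpa using hz), fun z hz w hw => ?_⟩
      exact h3 z (by simpa using hz) w (by simpa using hw)
    · have hd1 : y - x ≠ 1 → c < y - x := fun h =>
        hlarge (y - x) (by simp) (by lia) h
      obtain ⟨A₁, hsub, hcard₁, hgap₁, hzero₁⟩ := hgap.exists_superset (d := y - x) (by lia) (by
        by_cases h : y - x = 1
        · refine Or.inl ⟨h, fun h0 => ?_⟩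
          have := hzero h0
          simp [h] at this
        · exact Or.inr ⟨hd1 h, by lia⟩)
      -- If `0 ∈ A₁`, then `0` was already in `A₀` or the present gap is `1`; in both cases no gap
      -- `1` remains.
      obtain ⟨A, h1, h2, h3⟩ := ih y A₁ hs' (by lia) hgap₁ (by lia) (fun h => by
          rcases hzero₁ h with h | h
          · have := hzero h; lia
          · simp only [h, beq_self_eq_true, if_true] at hone; lia) hlarge'
      have hne : ∀ z ∈ y :: l, z ≠ x := fun z hz => by have := hyl z hz; lia
      refine ⟨Function.update A x A₀, by simp, fun z hz => ?_, fun z hz w hw hzw => ?_⟩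
      · rcases List.mem_cons.mp hz with rfl | hz
        · simp [hcard, hgap]
        · rw [Function.update_of_ne (hne z hz)]
          exact h2 z hz
      · rcases List.mem_cons.mp hz with rfl | hz' <;> rcases List.mem_cons.mp hw with rfl | hw'
        · simp
        · rw [Function.update_self, Function.update_of_ne (hne w hw')]
          exact (hsub.trans h1.ge).trans (h3 y (by simp) w hw' (hyl w hw'))
        · have := hyl z hz'; lia
        · rw [Function.update_of_ne (hne w hw'), Function.update_of_ne (hne z hz')]
          exact h3 z hz' w hw' hzw

theorem exists_nested_hasNodalGap {J : Type*} [Fintype J] {c : ℕ} {e : J → ℕ} (he : ∀ j, c ≤ e j)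
    (hone : (successiveGaps e).count 1 ≤ 1)
    (hlarge : ∀ d ∈ successiveGaps e, d ≠ 0 → d ≠ 1 → c < d) :
    ∃ A : ℕ → Finset ℂ, (∀ j, (A (e j)).card = e j + 1 ∧ HasNodalGap c (A (e j))) ∧
      ∀ j j', e j ≤ e j' → A (e j) ⊆ A (e j') := by
  unfold successiveGaps at hone hlarge
  have hmem : ∀ x, x ∈ (Finset.univ.val.map e).sort (· ≤ ·) ↔ ∃ j, e j = x := by simp
  have hsort := Multiset.pairwise_sort (Finset.univ.val.map e) (· ≤ ·)
  revert hone hlarge hmem hsort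
  generalize (Finset.univ.val.map e).sort (· ≤ ·) = l
  intro hone hlarge hmem hsort
  cases l with
  | nil =>
    have : IsEmpty J := ⟨fun j => by simpa using (hmem (e j)).mpr ⟨j, rfl⟩⟩
    exact ⟨fun _ => ∅, by simp, by simp⟩
  | cons x l =>
    obtain ⟨j, hj⟩ := (hmem x).mp (by simp)
    obtain ⟨A₀, h1, h2, h3⟩ := exists_hasNodalGap (c := c) (m := x + 1) (by have := he j; lia)
    simp only [List.tail_cons, Multiset.coe_count, Multiset.mem_coe] at hone hlarge
    obtain ⟨A, -, h4, h5⟩ := exists_nested_hasNodalGap_of_isChain l x A₀ hsort h1 h3 hone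
      (fun h => absurd h h2) hlarge
    exact ⟨A, fun j => h4 _ ((hmem _).mpr ⟨j, rfl⟩), fun j j' h =>
      h5 _ ((hmem _).mpr ⟨j, rfl⟩) _ ((hmem _).mpr ⟨j', rfl⟩) h⟩

/-! ### Moments and powers of linear forms -/

/-- On a point set with a gap in its nodal polynomial there is a weight whose power moments of order
`0, …, b + c` are those of a delta function at `b`. -/
theorem HasNodalGap.exists_weight {b c : ℕ} {A : Finset ℂ} (hA : HasNodalGap c A)
    (hcard : A.card = b + 1) :
    ∃ w : ℂ → ℂ, (∀ s < b, ∑ z ∈ A, w z * z ^ s = 0) ∧ ∑ z ∈ A, w z * z ^ b = 1 ∧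
      ∀ s, b < s → s ≤ b + c → ∑ z ∈ A, w z * z ^ s = 0 := by
  classical
  obtain ⟨R, hR, hRc⟩ := hA
  rw [hcard] at hR hRc
  -- These weights extract the coefficient of `X ^ b` from the interpolant of the values on `A`.
  let w : ℂ → ℂ := fun z => (Lagrange.basis A id z).coeff b
  have key : ∀ P : Polynomial ℂ, P.degree < A.card → ∑ z ∈ A, w z * P.eval z = P.coeff b := by
    intro P hP
    conv_rhs => rw [Lagrange.eq_interpolate (v := id) Function.injective_id.injOn hP,
      Lagrange.interpolate_apply, Polynomial.finsetSum_coeff]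
    refine Finset.sum_congr rfl fun z _ => ?_
    rw [Polynomial.coeff_C_mul, mul_comm]
    rfl
  have key' : ∀ s ≤ b, ∑ z ∈ A, w z * z ^ s = if b = s then 1 else 0 := by
    intro s hs
    have := key (Polynomial.X ^ s) (by rw [Polynomial.degree_X_pow, hcard]; exact_mod_cast by lia)
    simpa [Polynomial.coeff_X_pow] using this
  refine ⟨w, fun s hs => ?_, ?_, fun s hs hs' => ?_⟩
  · rw [key' s hs.le, if_neg (by lia)]
  · simp [key' b le_rfl]
  -- On `A`, `z ^ s = -R(z) * z ^ (s - (b + 1))`; as `s ≤ b + c`, the gap keeps the degree of the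
  -- right side below `b`.
  · have hdeg : ∀ k, b ≤ k → (R * Polynomial.X ^ (s - (b + 1))).coeff k = 0 := by
      intro k hk
      rw [Polynomial.coeff_mul_X_pow']
      split_ifs with h
      · by_contra h'
        have := hRc _ h'
        lia
      · rfl
    have h1 := key (R * Polynomial.X ^ (s - (b + 1))) (by
      rw [hcard, Polynomial.degree_lt_iff_coeff_zero]
      intro k hk
      exact hdeg k (by lia))
    rw [hdeg b le_rfl] at h1
    rw [← neg_eq_zero, ← h1, ← Finset.sum_neg_distrib]
    refine Finset.sum_congr rfl fun z hz => ?_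
    have h2 : z ^ (b + 1) + R.eval z = 0 := by
      have := congrArg (Polynomial.eval z) hR
      rw [Polynomial.eval_prod, Finset.prod_eq_zero hz (by simp)] at this
      simpa using this.symm
    have h3 : z ^ s = z ^ (b + 1) * z ^ (s - (b + 1)) := by rw [← pow_add]; congr 1; lia
    rw [h3, Polynomial.eval_mul, Polynomial.eval_pow, Polynomial.eval_X]
    linear_combination (-(w z * z ^ (s - (b + 1)))) * h2

theorem MvPolynomial.IsHomogeneous.eq_sum_smul_X {σ : Type*} [Fintype σ] {L : MvPolynomial σ ℂ}
    (hL : L.IsHomogeneous 1) : L = ∑ i, coeff (Finsupp.single i 1) L • X i := by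
  classical
  ext m
  simp only [coeff_sum, coeff_smul, coeff_X, smul_eq_mul, mul_ite, mul_one, mul_zero]
  by_cases hm : m.degree = 1
  · obtain ⟨i, rfl⟩ := (Finsupp.sum_eq_one_iff m).mp hm
    rw [Finset.sum_eq_single i]
    · simp
    · intro k _ hk
      rw [if_neg]
      rwa [Finsupp.single_left_inj one_ne_zero]
    · simp
  · rw [hL.coeff_eq_zero hm, Finset.sum_eq_zero]
    intro i _
    rw [if_neg]
    rintro rfl
    simp at hm

/-- A monomial is a combination of powers of linear forms exactly when the corresponding combination
of point evaluations reads off its coefficient. -/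
theorem monomial_eq_sum_pow_iff {σ κ : Type*} [Fintype σ] [Fintype κ] (m : σ →₀ ℕ) (w : κ → ℂ)
    (l : κ → σ → ℂ) :
    monomial m (1 : ℂ) = ∑ k, C (w k) * (∑ i, l k i • X i) ^ m.degree ↔
      ∀ m' : σ →₀ ℕ, m'.degree = m.degree →
        (m'.multinomial : ℂ) * ∑ k, w k * ∏ i, l k i ^ m' i = if m = m' then 1 else 0 := by
  classical
  have hdeg : ∀ m' : σ →₀ ℕ, m'.sum (fun _ k => k) = m'.degree := fun m' => rfl
  have hcoeff : ∀ m' : σ →₀ ℕ, coeff m' (∑ k, C (w k) * (∑ i, l k i • X i) ^ m.degree) =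
      if m'.degree = m.degree then (m'.multinomial : ℂ) * ∑ k, w k * ∏ i, l k i ^ m' i else 0 := by
    intro m'
    simp only [coeff_sum, coeff_C_mul, coeff_linearCombination_X_pow_of_fintype, hdeg]
    split_ifs
    · rw [Finset.mul_sum]
      refine Finset.sum_congr rfl fun k _ => ?_
      rw [Finsupp.prod_fintype _ _ (by simp)]
      ring
    · simp
  rw [MvPolynomial.ext_iff]
  refine forall_congr' fun m' => ?_
  rw [hcoeff, coeff_monomial]
  by_cases h : m'.degree = m.degree
  · rw [if_pos h]
    exact ⟨fun h' _ => by convert h'.symm, fun h' => by convert (h' h).symm⟩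
  · have : m ≠ m' := by rintro rfl; exact h rfl
    simp [h, this]

theorem degree_cons {n : ℕ} (c : ℕ) (a : Fin n → ℕ) :
    (Finsupp.equivFunOnFinite.symm (Fin.cons c a : Fin (n + 1) → ℕ)).degree = c + ∑ i, a i := by
  rw [Finsupp.degree_eq_sum, Fin.sum_univ_succ]
  simp

theorem totalDegree_specialMonomial {n : ℕ} (c : ℕ) (a : Fin n → ℕ) :
    (specialMonomial c a).totalDegree = c + ∑ i, a i := by
  rw [specialMonomial_eq_monomial, totalDegree_monomial _ one_ne_zero, ← degree_cons]
  rfl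

theorem specialMonomial_eq_sum_pow_iff {n : ℕ} {κ : Type*} [Fintype κ] (c : ℕ) (a : Fin n → ℕ)
    (w : κ → ℂ) (l : κ → Fin (n + 1) → ℂ) :
    specialMonomial c a =
        ∑ k, C (w k) * (∑ i, l k i • X i) ^ (specialMonomial c a).totalDegree ↔
      ∀ (s : ℕ) (u : Fin n → ℕ), s + ∑ i, u i = c + ∑ i, a i →
        (Nat.multinomial Finset.univ (Fin.cons s u : Fin (n + 1) → ℕ) : ℂ) *
          ∑ k, w k * (l k 0 ^ s * ∏ i, l k i.succ ^ u i) = if c = s ∧ a = u then 1 else 0 := by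
  rw [totalDegree_specialMonomial, ← degree_cons, specialMonomial_eq_monomial,
    monomial_eq_sum_pow_iff, degree_cons]
  have hmult : ∀ (s : ℕ) (u : Fin n → ℕ),
      (Finsupp.equivFunOnFinite.symm (Fin.cons s u : Fin (n + 1) → ℕ)).multinomial =
        Nat.multinomial Finset.univ (Fin.cons s u : Fin (n + 1) → ℕ) := by
    intro s u
    rw [← Finsupp.multinomial_of_support_subset (Finset.subset_univ _)]
    rfl
  have hprod : ∀ (s : ℕ) (u : Fin n → ℕ) (k : κ),
      ∏ i, l k i ^ (Finsupp.equivFunOnFinite.symm (Fin.cons s u : Fin (n + 1) → ℕ)) i =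
        l k 0 ^ s * ∏ i, l k i.succ ^ u i := by
    intro s u k
    rw [Fin.prod_univ_succ]
    simp
  constructor
  · intro h s u hsu
    have := h (Finsupp.equivFunOnFinite.symm (Fin.cons s u : Fin (n + 1) → ℕ))
      (by rw [degree_cons, hsu])
    simpa only [hmult, hprod, Finsupp.equivFunOnFinite.symm.injective.eq_iff, Fin.cons_inj]
      using this
  · intro h m' hm'
    obtain ⟨f, rfl⟩ := Finsupp.equivFunOnFinite.symm.surjective m'
    obtain ⟨s, u, rfl⟩ : ∃ (s : ℕ) (u : Fin n → ℕ), f = Fin.cons s u :=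
      ⟨f 0, Fin.tail f, (Fin.cons_self_tail f).symm⟩
    rw [degree_cons] at hm'
    simpa only [hmult, hprod, Finsupp.equivFunOnFinite.symm.injective.eq_iff, Fin.cons_inj]
      using h s u hm'

/-! ### The lower bound -/

/-- The exponents, in the variables other than `x₀`, of the divisors of the members of the family. -/
def divisorExponents {n : ℕ} {J : Type*} [Fintype J] (a : J → Fin n → ℕ) : Finset (Fin n → ℕ) :=
  Finset.univ.biUnion fun j => Fintype.piFinset fun i => Finset.range (a j i + 1)

theorem mem_divisorExponents {n : ℕ} {J : Type*} [Fintype J] {a : J → Fin n → ℕ} {u : Fin n → ℕ} :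
    u ∈ divisorExponents a ↔ ∃ j, ∀ i, u i ≤ a j i := by
  simp [divisorExponents]

theorem card_divisorExponents_le {n : ℕ} {J : Type*} [Fintype J] {c : ℕ} (hc : 1 ≤ c)
    {a : J → Fin n → ℕ} {r : ℕ}
    (h : HasSimultaneousDecomposition (fun j => specialMonomial c (a j)) r) :
    (divisorExponents a).card ≤ r := by
  classical
  obtain ⟨L, hL, hF⟩ := h
  by_contra! hlt
  let l : Fin r → Fin (n + 1) → ℂ := fun k i => coeff (Finsupp.single i 1) (L k)
  -- Forms with `l k 0 = 0` impose no condition here; the factor `x₀ ^ c` with `c ≥ 1` deals with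
  -- them in `hhom`.
  let Φ : (divisorExponents a → ℂ) →ₗ[ℂ] (Fin r → ℂ) :=
    Fintype.linearCombination ℂ fun (u : divisorExponents a) (k : Fin r) =>
      if l k 0 = 0 then 0 else ∏ i, (l k (Fin.succ i) / l k 0) ^ u.1 i
  have hker := LinearMap.ker_ne_bot_of_finrank_lt (f := Φ) (by simpa using hlt)
  obtain ⟨g, hg, hg0⟩ := Submodule.exists_mem_ne_zero_of_ne_bot hker
  have hvan : ∀ k, l k 0 ≠ 0 → ∑ u, g u * ∏ i, (l k (Fin.succ i) / l k 0) ^ u.1 i = 0 := by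
    intro k hk
    have := congrFun (LinearMap.mem_ker.mp hg) k
    simpa [Φ, Fintype.linearCombination_apply, hk] using this
  have hsupp : (Finset.univ.filter fun u => g u ≠ 0).Nonempty := by
    obtain ⟨u, hu⟩ := Function.ne_iff.mp hg0
    exact ⟨u, by simpa using hu⟩
  obtain ⟨u₀, hu₀, hmax⟩ := Finset.exists_max_image _ (fun u => ∑ i, u.1 i) hsupp
  simp only [Finset.mem_filter, Finset.mem_univ, true_and] at hu₀ hmax
  set t := ∑ i, u₀.1 i with ht
  obtain ⟨j, hj⟩ := mem_divisorExponents.mp u₀.2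
  -- Homogenize the relation to degree `t` and multiply by `x₀ ^ c` and the cofactor `x ^ (a j -
  -- u₀)`: the degree becomes that of the `j`-th monomial, and the term of `u₀` becomes that
  -- monomial itself.
  have hhom : ∀ k, ∑ u, g u * (l k 0 ^ (c + (t - ∑ i, u.1 i)) *
      ∏ i, l k (Fin.succ i) ^ (a j i - u₀.1 i + u.1 i)) = 0 := by
    intro k
    by_cases hk : l k 0 = 0
    · refine Finset.sum_eq_zero fun u _ => ?_
      rw [hk, zero_pow (by lia), zero_mul, mul_zero]
    · have h1 := hvan k hk
      rw [← mul_zero (l k 0 ^ (c + t) * ∏ i, l k (Fin.succ i) ^ (a j i - u₀.1 i)), ← h1,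
        Finset.mul_sum]
      refine Finset.sum_congr rfl fun u _ => ?_
      by_cases hu : g u = 0
      · simp [hu]
      have hle := hmax u hu
      simp only [div_pow, Finset.prod_div_distrib, Finset.prod_pow_eq_pow_sum, pow_add,
        Finset.prod_mul_distrib]
      have h2 : l k 0 ^ t = l k 0 ^ (t - ∑ i, u.1 i) * l k 0 ^ (∑ i, u.1 i) := by
        rw [← pow_add, Nat.sub_add_cancel hle]
      rw [h2]
      field_simp
  obtain ⟨w, hw⟩ := hF j
  have hLl : ∀ k, L k = ∑ i, l k i • X i := fun k => (hL k).eq_sum_smul_X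
  simp only [hLl] at hw
  rw [specialMonomial_eq_sum_pow_iff] at hw
  have hmom : ∀ u, g u ≠ 0 → (∑ k, w k * (l k 0 ^ (c + (t - ∑ i, u.1 i)) *
      ∏ i, l k (Fin.succ i) ^ (a j i - u₀.1 i + u.1 i)) ≠ 0 ↔ u = u₀) := by
    intro u hu
    have hle := hmax u hu
    have hsum : ∑ i, (a j i - u₀.1 i) + t = ∑ i, a j i := by
      rw [ht, ← Finset.sum_add_distrib]
      exact Finset.sum_congr rfl fun i _ => Nat.sub_add_cancel (hj i)
    have h1 := hw (c + (t - ∑ i, u.1 i)) (fun i => a j i - u₀.1 i + u.1 i)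
      (by rw [Finset.sum_add_distrib]; lia)
    have hiff : (c = c + (t - ∑ i, u.1 i) ∧ a j = fun i => a j i - u₀.1 i + u.1 i) ↔ u = u₀ := by
      constructor
      · rintro ⟨-, h⟩
        refine Subtype.ext (funext fun i => ?_)
        have := congrFun h i
        have := hj i
        lia
      · rintro rfl
        exact ⟨by lia, funext fun i => (Nat.sub_add_cancel (hj i)).symm⟩
    rw [← hiff]
    constructor
    · intro h
      by_contra hn
      rw [if_neg hn] at h1
      exact mul_ne_zero (Nat.cast_ne_zero.mpr (Nat.multinomial_pos _ _).ne') h h1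
    · intro h h0
      rw [if_pos h, h0, mul_zero] at h1
      exact zero_ne_one h1
  have hzero : ∑ u, g u * ∑ k, w k * (l k 0 ^ (c + (t - ∑ i, u.1 i)) *
      ∏ i, l k (Fin.succ i) ^ (a j i - u₀.1 i + u.1 i)) = 0 := by
    simp only [Finset.mul_sum]
    rw [Finset.sum_comm]
    refine Finset.sum_eq_zero fun k _ => ?_
    rw [← mul_zero (w k), ← hhom k, Finset.mul_sum]
    exact Finset.sum_congr rfl fun u _ => mul_left_comm _ _ _
  rw [Finset.sum_eq_single u₀] at hzero
  · exact mul_ne_zero hu₀ ((hmom u₀ hu₀).mpr rfl) hzero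
  · intro u _ hne
    by_cases hu : g u = 0
    · rw [hu, zero_mul]
    · rw [not_ne_iff.mp (mt (hmom u hu).mp hne), mul_zero]
  · simp

/-! ### The upper bound and the count -/

/-- Grids over nested point sets with a gap in their nodal polynomials decompose the family. -/
theorem hasSimultaneousDecomposition_of_nested {n : ℕ} {J : Type*} [Fintype J] {c : ℕ}
    {a : J → Fin n → ℕ} {A : Fin n → ℕ → Finset ℂ}
    (hA : ∀ i j, (A i (a j i)).card = a j i + 1 ∧ HasNodalGap c (A i (a j i))) :
    HasSimultaneousDecomposition (fun j => specialMonomial c (a j))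
      (Finset.univ.biUnion fun j => Fintype.piFinset fun i => A i (a j i)).card := by
  classical
  choose w hw0 hw1 hw2 using fun i j => (hA i j).2.exists_weight (hA i j).1
  set G := Finset.univ.biUnion fun j => Fintype.piFinset fun i => A i (a j i) with hG
  let l : Fin G.card → Fin (n + 1) → ℂ := fun k => Fin.cons 1 (G.equivFin.symm k).1
  refine ⟨fun k => ∑ i, l k i • X i, fun k => ?_, fun j => ?_⟩
  · refine IsHomogeneous.sum _ _ _ fun i _ => ?_
    rw [smul_eq_C_mul]
    exact isHomogeneous_C_mul_X _ _
  have hsub : (Fintype.piFinset fun i => A i (a j i)) ⊆ G :=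
    Finset.subset_biUnion_of_mem (fun j => Fintype.piFinset fun i => A i (a j i))
      (Finset.mem_univ j)
  set M : ℂ := (Nat.multinomial Finset.univ (Fin.cons c (a j) : Fin (n + 1) → ℕ) : ℂ) with hM
  -- The factor `M⁻¹` cancels the multinomial coefficient in the expansion of a power of a linear
  -- form.
  let W : (Fin n → ℂ) → ℂ := fun p =>
    if p ∈ Fintype.piFinset fun i => A i (a j i) then M⁻¹ * ∏ i, w i j (p i) else 0
  refine ⟨fun k => W (G.equivFin.symm k).1, ?_⟩
  rw [specialMonomial_eq_sum_pow_iff]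
  intro s u hsu
  have hsum : ∑ k, W (G.equivFin.symm k).1 * (l k 0 ^ s * ∏ i : Fin n, l k i.succ ^ u i) =
      M⁻¹ * ∏ i, ∑ z ∈ A i (a j i), w i j z * z ^ u i := by
    rw [Finset.prod_univ_sum, Finset.mul_sum]
    simp only [l, Fin.cons_zero, Fin.cons_succ, one_pow, one_mul]
    rw [Equiv.sum_comp G.equivFin.symm (fun p : G => W p.1 * ∏ i, p.1 i ^ u i),
      Finset.sum_coe_sort G (fun p => W p * ∏ i, p i ^ u i), ← Finset.sum_subset hsub]
    · refine Finset.sum_congr rfl fun p hp => ?_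
      simp only [W, if_pos hp, Finset.prod_mul_distrib, mul_assoc]
    · intro p _ hp
      simp only [W, if_neg hp, zero_mul]
  rw [hsum]
  split_ifs with h
  · obtain ⟨rfl, rfl⟩ := h
    have hM0 : M ≠ 0 := Nat.cast_ne_zero.mpr (Nat.multinomial_pos _ _).ne'
    rw [Finset.prod_eq_one fun i _ => hw1 i j, mul_one, ← hM, mul_inv_cancel₀ hM0]
  · have hex : ∃ i, ∑ z ∈ A i (a j i), w i j z * z ^ u i = 0 := by
      by_contra! hne
      have hle : ∀ i, a j i ≤ u i := fun i => by
        by_contra! hlt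
        exact hne i (hw0 i j _ hlt)
      have heq : ∀ i, a j i = u i := fun i => by
        by_contra hlt
        refine hne i (hw2 i j _ (lt_of_le_of_ne (hle i) hlt) ?_)
        -- Since `u ≥ a j` and the total degree is `c + ∑ i, a j i`, no coordinate exceeds that of
        -- `a j` by more than `c`, so the moments stay in the controlled range.
        have h1 : ∑ k, u k = ∑ k, (u k - a j k) + ∑ k, a j k := by
          rw [← Finset.sum_add_distrib]
          exact Finset.sum_congr rfl fun k _ => (Nat.sub_add_cancel (hle k)).symm
        have h2 := Finset.single_le_sum (f := fun k => u k - a j k) (fun _ _ => Nat.zero_le _)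
          (Finset.mem_univ i)
        lia
      have hau : a j = u := funext heq
      subst hau
      exact h ⟨by lia, rfl⟩
    obtain ⟨i, hi⟩ := hex
    rw [Finset.prod_eq_zero (Finset.mem_univ i) hi, mul_zero, mul_zero]

/-- Inclusion-exclusion for a union of grids over nested sets. -/
theorem card_biUnion_piFinset_of_nested {n : ℕ} {J α : Type*} [Fintype J] [DecidableEq α]
    {a : J → Fin n → ℕ} {A : Fin n → ℕ → Finset α} (hcard : ∀ i j, (A i (a j i)).card = a j i + 1)
    (hA : ∀ i j j', a j i ≤ a j' i → A i (a j i) ⊆ A i (a j' i)) :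
    ((Finset.univ.biUnion fun j => Fintype.piFinset fun i => A i (a j i)).card : ℤ) =
      ∑ S : {S : Finset J // S.Nonempty},
        (-1 : ℤ) ^ (S.1.card + 1) * ((∏ i, (S.1.inf' S.2 (fun j => a j i) + 1) : ℕ) : ℤ) := by
  classical
  rw [Finset.inclusion_exclusion_card_biUnion]
  refine Fintype.sum_equiv (Equiv.subtypeEquivRight (by simp)) _ _ fun S => ?_
  have hS : S.1.Nonempty := (Finset.mem_filter.mp S.2).2
  have hinf : S.1.inf' hS (fun j => Fintype.piFinset fun i => A i (a j i)) =
      Fintype.piFinset fun i => A i (S.1.inf' hS (fun j => a j i)) := by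
    ext p
    simp only [Finset.mem_inf', Fintype.mem_piFinset]
    constructor
    · intro h i
      obtain ⟨j, hj, hji⟩ := Finset.exists_mem_eq_inf' hS (fun j => a j i)
      rw [hji]
      exact h j hj i
    · intro h j hj i
      obtain ⟨j', hj', hji⟩ := Finset.exists_mem_eq_inf' hS (fun j => a j i)
      refine hA i j' j ?_ (by rw [← hji]; exact h i)
      rw [← hji]
      exact Finset.inf'_le _ hj
  have hcard' : ∀ i, (A i (S.1.inf' hS (fun j => a j i))).card =
      S.1.inf' hS (fun j => a j i) + 1 := by
    intro i
    obtain ⟨j, hj, hji⟩ := Finset.exists_mem_eq_inf' hS (fun j => a j i)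
    rw [hji]
    exact hcard i j
  rw [hinf, Fintype.card_piFinset, Finset.prod_congr rfl fun i _ => hcard' i]
  rfl

theorem simultaneousWaringRank_of_isFree {n : ℕ} {J : Type*} [Fintype J] {c : ℕ} (hc : 1 ≤ c)
    {a : J → Fin n → ℕ} (ha : ∀ j i, c ≤ a j i) (hfree : IsFree c a) :
    (∃ r, HasSimultaneousDecomposition (fun j => specialMonomial c (a j)) r) ∧
    (simultaneousWaringRank (fun j => specialMonomial c (a j)) : ℤ) =
      ∑ S : {S : Finset J // S.Nonempty},
        (-1 : ℤ) ^ (S.1.card + 1) * ((∏ i, (S.1.inf' S.2 (fun j => a j i) + 1) : ℕ) : ℤ) := by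
  classical
  choose A hA hA' using fun i =>
    exists_nested_hasNodalGap (fun j => ha j i) (hfree.1 i) (hfree.2 i)
  have hdec := hasSimultaneousDecomposition_of_nested hA
  have hcard := card_biUnion_piFinset_of_nested (fun i j => (hA i j).1) hA'
  -- The boxes of the lower bound are themselves grids over nested sets, so the same count applies
  -- to them.
  have hexp := card_biUnion_piFinset_of_nested (a := a) (A := fun _ b => Finset.range (b + 1))
    (by simp) (fun i j j' h => by simpa using h)
  have heq := Nat.cast_injective (R := ℤ) (hcard.trans hexp.symm)
  refine ⟨⟨_, hdec⟩, ?_⟩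
  rw [← hcard]
  refine congrArg _ (le_antisymm (Nat.sInf_le hdec) (le_csInf ⟨_, hdec⟩ fun r hr => ?_))
  rw [heq]
  have hle := card_divisorExponents_le hc hr
  unfold divisorExponents at hle
  refine hle.trans' (le_of_eq ?_)
  congr!

theorem isFree_unit {n : ℕ} (c : ℕ) (a : Fin n → ℕ) : IsFree c (fun _ : Unit => a) := by
  have : ∀ i, successiveGaps (fun _ : Unit => a i) = 0 := by
    intro i
    simp [successiveGaps]
  exact ⟨fun i => by simp [this], fun i => by simp [this]⟩

theorem waringRank_specialMonomial {n : ℕ} {c : ℕ} (hc : 1 ≤ c) {a : Fin n → ℕ}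
    (ha : ∀ i, c ≤ a i) :
    (∃ r, HasSimultaneousDecomposition (fun _ : Unit => specialMonomial c a) r) ∧
      waringRank (specialMonomial c a) = ∏ i, (a i + 1) := by
  obtain ⟨h1, h2⟩ := simultaneousWaringRank_of_isFree hc (fun _ => ha) (isFree_unit c a)
  refine ⟨h1, Nat.cast_injective (R := ℤ) (h2.trans ?_)⟩
  have : Unique {S : Finset Unit // S.Nonempty} :=
    { default := ⟨{()}, by simp⟩
      uniq := fun S => Subtype.ext (by
        obtain ⟨x, hx⟩ := S.2
        ext y
        simpa using hx) }
  rw [Fintype.sum_unique]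
  obtain ⟨S, hS⟩ := (default : {S : Finset Unit // S.Nonempty})
  obtain rfl : S = {()} := by
    obtain ⟨x, hx⟩ := hS
    ext y
    simpa using hx
  simp

theorem mainTheorem2 {n : ℕ} {J : Type*} [Fintype J] (c : ℕ) (hc : 1 ≤ c)
    (a : J → Fin n → ℕ) (ha : ∀ j i, c ≤ a j i) (hfree : IsFree c a) :
    (∃ r, HasSimultaneousDecomposition (fun j => specialMonomial c (a j)) r) ∧
    (∀ (S : Finset J) (hS : S.Nonempty),
      ∃ r, HasSimultaneousDecomposition (fun _ : Unit => gcdSpecialMonomial c a S hS) r) ∧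
    (simultaneousWaringRank (fun j => specialMonomial c (a j)) : ℤ) =
      ∑ S : {S : Finset J // S.Nonempty},
        (-1 : ℤ) ^ (S.1.card + 1) * (waringRank (gcdSpecialMonomial c a S.1 S.2) : ℤ) := by
  obtain ⟨h1, h2⟩ := simultaneousWaringRank_of_isFree hc ha hfree
  have hgcd := fun (S : Finset J) (hS : S.Nonempty) =>
    waringRank_specialMonomial hc (a := fun i => S.inf' hS (fun j => a j i))
      (fun i => Finset.le_inf' _ _ fun j _ => ha j i)
  refine ⟨h1, fun S hS => (hgcd S hS).1, h2.trans (Finset.sum_congr rfl fun S _ => ?_)⟩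
  rw [gcdSpecialMonomial, (hgcd S.1 S.2).2]

end
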